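/- Let $k$ be a field of characteristic $0$, and let $n_1<n_2<n_3$ be positive integers with $\gcd(n_1,n_2,n_3)=1$ which minimally generate the numerical semigroup $G=\langle n_1,n_2,n_3\rangle=\{a_1n_1+a_2n_2+a_3n_3 : a_i\in\mathbb{Z}_{\ge 0}\}$, i.e. no $n_i$ lies in the semigroup generated by the other two. Let $R=k[[t^{n_1},t^{n_2},t^{n_3}]]\subseteq k[[t]]$ be the associated numerical semigroup ring, with maximal ideal $\mathfrak m=(t^{n_1},t^{n_2},t^{n_3})R$, and let $Q=t^{n_1}R$, a principal reduction of $\mathfrak m$. Let $$\mathrm{s}_Q(\mathfrak m)=\min\{s\ge 0 : \mathfrak m^{s+1}\subseteq Q\},\qquad \mathrm{r}_Q(\mathfrak m)=\min\{r\ge 0 : \mathfrak m^{r+1}=Q\,\mathfrak m^{r}\}$$ be the index of nilpotency and the reduction number of $\mathfrak m$ with respect to $Q$. If $\mathrm{s}_Q(\mathfrak m)=\mathrm{r}_Q(\mathfrak m)$, then the tangent cone $\operatorname{gr}_{\mathfrak m}(R)=\bigoplus_{i\ge 0}\mathfrak m^i/\mathfrak m^{i+1}$ is a Cohen–Macaulay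 ring. -/

import Mathlib

open scoped PowerSeries

noncomputable section

namespace NumericalSemigroupRing

/-- The semigroup `⟨n₁, …, n_d⟩ = {∑ aᵢ nᵢ : aᵢ ∈ ℕ₀}` (zero included). -/
def semigroup {d : ℕ} (n : Fin d → ℕ) : AddSubmonoid ℕ :=
  AddSubmonoid.closure (Set.range n)

/-- The generators `n₁, …, n_d` are a minimal system of generators of `⟨n₁, …, n_d⟩`: none of
them lies in the semigroup generated by the others. -/
def IsMinimalGenerators {d : ℕ} (n : Fin d → ℕ) : Prop :=
  ∀ i, n i ∉ AddSubmonoid.closure (n '' {j | j ≠ i})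

/-- The numerical semigroup ring `R = k⟦t^{n₁}, …, t^{n_d}⟧`, as a subring of `k⟦t⟧`: the power
series in `t` all of whose exponents lie in the semigroup `⟨n₁, …, n_d⟩`. By
`mem_ring_iff_exists_subst` below it is the image of `k⟦x₁, …, x_d⟧` under `xᵢ ↦ t^{nᵢ}`. -/
def ring (k : Type*) [Field k] {d : ℕ} (n : Fin d → ℕ) : Subalgebra k k⟦X⟧ where
  carrier := {f | ∀ a, PowerSeries.coeff a f ≠ 0 → a ∈ semigroup n}
  mul_mem' := by
    intro f g hf hg a ha
    rw [PowerSeries.coeff_mul] at ha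
    obtain ⟨p, hp, hne⟩ := Finset.exists_ne_zero_of_sum_ne_zero ha
    rw [← Finset.HasAntidiagonal.mem_antidiagonal.mp hp]
    exact add_mem (hf _ (left_ne_zero_of_mul hne)) (hg _ (right_ne_zero_of_mul hne))
  add_mem' := by
    intro f g hf hg a ha
    by_cases h : PowerSeries.coeff a f = 0
    · exact hg a (by simpa [h] using ha)
    · exact hf a h
  algebraMap_mem' := by
    intro c a ha
    by_cases h : a = 0
    · simp [h]
    · exact absurd (by simp [PowerSeries.coeff_C, h]) ha

theorem mem_semigroup_iff {d : ℕ} (n : Fin d → ℕ) (a : ℕ) :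
    a ∈ semigroup n ↔ ∃ e : Fin d →₀ ℕ, ∑ i, e i * n i = a := by
  rw [semigroup, ← Submodule.span_nat_eq_addSubmonoidClosure, Submodule.mem_toAddSubmonoid,
    Submodule.mem_span_range_iff_exists_fun]
  constructor
  · rintro ⟨c, hc⟩
    exact ⟨Finsupp.equivFunOnFinite.symm c, by simpa using hc⟩
  · rintro ⟨e, he⟩
    exact ⟨e, by simpa using he⟩

theorem hasSubst_X_pow (k : Type*) [Field k] {d : ℕ} (n : Fin d → ℕ) (hn : ∀ i, 0 < n i) :
    MvPowerSeries.HasSubst (fun i => (PowerSeries.X : k⟦X⟧) ^ n i) := by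
  apply MvPowerSeries.hasSubst_of_constantCoeff_zero
  intro i
  rw [map_pow]
  have h : MvPowerSeries.constantCoeff (PowerSeries.X : k⟦X⟧) = 0 :=
    PowerSeries.constantCoeff_X
  rw [h, zero_pow (hn i).ne']

theorem coeff_subst_X_pow (k : Type*) [Field k] {d : ℕ} (n : Fin d → ℕ) (hn : ∀ i, 0 < n i)
    (F : MvPowerSeries (Fin d) k) (a : ℕ) :
    PowerSeries.coeff a (MvPowerSeries.subst (fun i => (PowerSeries.X : k⟦X⟧) ^ n i) F : k⟦X⟧) =
      ∑ᶠ e : Fin d →₀ ℕ, if a = ∑ i, e i * n i then MvPowerSeries.coeff e F else 0 := by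
  rw [PowerSeries.coeff, MvPowerSeries.coeff_subst (hasSubst_X_pow k n hn)]
  apply finsum_congr
  intro e
  have h : (e.prod fun s m => ((PowerSeries.X : k⟦X⟧) ^ n s) ^ m) =
      PowerSeries.X ^ (∑ i, e i * n i) := by
    rw [Finsupp.prod_fintype _ _ (by simp), ← Finset.prod_pow_eq_pow_sum]
    exact Finset.prod_congr rfl fun i _ => by rw [← pow_mul, mul_comm]
  rw [h]
  change _ • PowerSeries.coeff a (PowerSeries.X ^ (∑ i, e i * n i) : k⟦X⟧) = _
  rw [PowerSeries.coeff_X_pow]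
  split_ifs <;> simp

/-- `R` is the image of the map `k⟦x₁, …, x_d⟧ → k⟦t⟧` with `xᵢ ↦ t^{nᵢ}`. -/
theorem mem_ring_iff_exists_subst (k : Type*) [Field k] {d : ℕ} (n : Fin d → ℕ)
    (hn : ∀ i, 0 < n i) (f : k⟦X⟧) :
    f ∈ ring k n ↔ ∃ F : MvPowerSeries (Fin d) k,
      MvPowerSeries.subst (fun i => (PowerSeries.X : k⟦X⟧) ^ n i) F = f := by
  classical
  constructor
  · intro hf
    have hf' : ∀ a, PowerSeries.coeff a f ≠ 0 → ∃ e : Fin d →₀ ℕ, ∑ i, e i * n i = a :=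
      fun a ha => (mem_semigroup_iff n a).mp (hf a ha)
    choose! c hc using hf'
    obtain ⟨F, hF⟩ : ∃ F : MvPowerSeries (Fin d) k, ∀ e, MvPowerSeries.coeff e F =
        if c (∑ i, e i * n i) = e then PowerSeries.coeff (∑ i, e i * n i) f else 0 :=
      ⟨fun e => if c (∑ i, e i * n i) = e then PowerSeries.coeff (∑ i, e i * n i) f else 0,
        fun _ => rfl⟩
    refine ⟨F, ?_⟩
    ext a
    rw [coeff_subst_X_pow k n hn, finsum_eq_single _ (c a)]
    · rw [hF]
      by_cases ha : PowerSeries.coeff a f = 0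
      · split_ifs with h1 h2
        · rw [← h1]
        · exact ha.symm
        · exact ha.symm
      · simp [hc a ha]
    · intro e he
      rw [hF]
      split_ifs with h1 h2
      · exact absurd (by rw [h1, h2]) he
      · rfl
      · rfl
  · rintro ⟨F, rfl⟩ a ha
    rw [coeff_subst_X_pow k n hn] at ha
    rw [mem_semigroup_iff]
    by_contra hne
    exact ha (finsum_eq_zero_of_forall_eq_zero fun e => if_neg fun h => hne ⟨e, h.symm⟩)

theorem X_pow_mem_ring (k : Type*) [Field k] {d : ℕ} (n : Fin d → ℕ) (i : Fin d) :
    (PowerSeries.X : k⟦X⟧) ^ n i ∈ ring k n := by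
  intro a ha
  rw [PowerSeries.coeff_X_pow] at ha
  have h : a = n i := by
    by_contra hne
    exact ha (if_neg hne)
  exact h ▸ AddSubmonoid.subset_closure ⟨i, rfl⟩

/-- The element `t^{nᵢ}` of `R`. -/
def gen (k : Type*) [Field k] {d : ℕ} (n : Fin d → ℕ) (i : Fin d) : ring k n :=
  ⟨PowerSeries.X ^ n i, X_pow_mem_ring k n i⟩

/-- The maximal ideal `𝔪 = (t^{n₁}, …, t^{n_d})R` of `R`. -/
def maxIdeal (k : Type*) [Field k] {d : ℕ} (n : Fin d → ℕ) : Ideal (ring k n) :=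
  Ideal.span (Set.range (gen k n))

end NumericalSemigroupRing

namespace TangentCone

/-- The index of nilpotency `s_Q(I) = min {s | I^{s+1} ⊆ Q}`. -/
def nilpotencyIndex {R : Type*} [CommRing R] (Q I : Ideal R) : ℕ :=
  sInf {s | I ^ (s + 1) ≤ Q}

/-- The reduction number `r_Q(I) = min {r | I^{r+1} = Q I^r}`. -/
def reductionNumber {R : Type*} [CommRing R] (Q I : Ideal R) : ℕ :=
  sInf {r | I ^ (r + 1) = Q * I ^ r}

/-- The associated graded ring `gr_I(R) = ⨁ Iⁱ/Iⁱ⁺¹`, as the quotient `R[It] / I·R[It]` of the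
Rees algebra `R[It] = ⨁ Iⁱtⁱ`. For `I` the maximal ideal of a local ring it is the tangent
cone. -/
abbrev associatedGraded {R : Type*} [CommRing R] (I : Ideal R) : Type _ :=
  reesAlgebra I ⧸ I.map (algebraMap R (reesAlgebra I))

/-- A local ring is Cohen–Macaulay if it is Noetherian and its maximal ideal contains a regular
sequence whose length is the Krull dimension. -/
structure IsCohenMacaulayLocal (A : Type*) [CommRing A] [IsLocalRing A] : Prop where
  isNoetherianRing : IsNoetherianRing A
  exists_isRegular : ∃ rs : List A, (∀ r ∈ rs, r ∈ IsLocalRing.maximalIdeal A) ∧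
    RingTheory.Sequence.IsRegular A rs ∧ ((rs.length : ℕ) : WithBot ℕ∞) = ringKrullDim A

/-- A commutative ring is Cohen–Macaulay if it is Noetherian and all its localizations at prime
ideals are Cohen–Macaulay local rings. -/
structure IsCohenMacaulay (A : Type*) [CommRing A] : Prop where
  isNoetherianRing : IsNoetherianRing A
  localization : ∀ (p : Ideal A) [p.IsPrime], IsCohenMacaulayLocal (Localization.AtPrime p)

end TangentCone

end

/-! Write x < y < z for the generators and G for the semigroup; the order of an element of G is the
largest number of generators summing to it. A series lies in 𝔪ⁱ exactly when all its exponents have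
order at least i (`maxIdeal_pow`), so the problem becomes one about orders.

Since Q is a reduction, the tangent cone is finite over k[X], with X acting as the class of t^x. If
that class is a nonzerodivisor, the tangent cone is torsion-free over this PID, hence Cohen–Macaulay
(`isCohenMacaulay_associatedGraded`). On exponents the condition reads: adding x to an element of G
raises its order by at most one (`order_add_smallest`).

Cancelling common summands and comparing sizes leaves one possible obstruction: a multiple of y that
lies in x + G, with every representation using x too short. Only the least such multiple βy matters
(`order_multiple`).

Put s = s_Q(𝔪) = r_Q(𝔪). The reduction number says that every by + cz with b + c = s + 1 is x plus
an element of order at least s. The nilpotency index says that some by + cz with b + c = s avoids x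
+ G. Together these are incompatible with a bad βy (`order_core`). -/

/-! ### Orders in a semigroup with three generators -/

namespace NumericalSemigroupRing

/-- Besides βy = (p+1)x + qz, reducing βy + kz with k = s + 1 - β gives a second relation ey + gz =
(r+1)x, taken with g least. The element by + cz outside x + G forces b < e and c < q + g. Reducing a
further element of length s + 1, just below the second relation in z, then contradicts one of these
choices in every case. -/
theorem order_core {x y z s β p q b c : ℕ} (hx : 0 < x) (hxy : x < y) (hyz : y < z)
    (hβ : β * y = (p + 1) * x + q * z)
    (hmin : ∀ b u v w, b * y = (u + 1) * x + v * y + w * z → β ≤ b)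
    (hbad : ∀ u v w, β * y = (u + 1) * x + v * y + w * z → u + v + w + 1 < β)
    (hred : ∀ b c, b + c = s + 1 →
      ∃ u v w, (u + 1) * x + v * y + w * z = b * y + c * z ∧ s ≤ u + v + w)
    (hbc : b + c = s) (hw : ∀ u v w, b * y + c * z ≠ (u + 1) * x + v * y + w * z) : False := by
  have hw' : ∀ b' c' u v w, b' ≤ b → c' ≤ c →
      b' * y + c' * z ≠ (u + 1) * x + v * y + w * z := by
    intro b' c' u v w hb hc h
    obtain ⟨d, rfl⟩ := Nat.exists_eq_add_of_le hb
    obtain ⟨d', rfl⟩ := Nat.exists_eq_add_of_le hc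
    exact hw u (v + d) (w + d') (by linarith)
  have hb : b < β := by
    by_contra! h
    obtain ⟨d, rfl⟩ := Nat.exists_eq_add_of_le h
    exact hw p d (q + c) (by linarith)
  have hs : β ≤ s := by
    by_contra! h
    obtain ⟨u, v, w, h1, h2⟩ := hred (s + 1) 0 rfl
    have h3 := hmin (s + 1) u v w (by linarith)
    obtain rfl : β = s + 1 := by omega
    have := hbad u v w (by linarith)
    omega
  obtain ⟨k, hk⟩ := Nat.exists_eq_add_of_le (show β ≤ s + 1 by omega)
  have hpq : p + q + 1 < β := by simpa using hbad p 0 q (by linarith)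
  -- Reduce βy + kz. Cancelling all of kz would give βy a long representation; cancelling all of βy
  -- would put kz in x + G, although k ≤ c. So both y and z survive on the left.
  have hex : ∃ g, 1 ≤ g ∧ g ≤ k ∧ ∃ e r, 1 ≤ e ∧ e ≤ β ∧ e * y + g * z = (r + 1) * x := by
    obtain ⟨u, v, w, h1, h2⟩ := hred β k hk.symm
    have hwk : w < k := by
      by_contra! h
      obtain ⟨d, rfl⟩ := Nat.exists_eq_add_of_le h
      have := hbad u v d (by linarith)
      omega
    have hvβ : v < β := by
      by_contra! h
      obtain ⟨d, rfl⟩ := Nat.exists_eq_add_of_le h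
      exact hw' 0 k u d w (by omega) (by omega) (by linarith)
    obtain ⟨d, hd⟩ := Nat.exists_eq_add_of_le hwk.le
    obtain ⟨d', hd'⟩ := Nat.exists_eq_add_of_le hvβ.le
    refine ⟨d, by omega, by omega, d', u, by omega, by omega, ?_⟩
    rw [hd, hd'] at h1
    linarith
  classical
  obtain ⟨hg1, hgk, e, r, he1, heβ, her⟩ := Nat.find_spec hex
  have hgmin := fun m (hm : m < Nat.find hex) => Nat.find_min hex hm
  generalize Nat.find hex = g at *
  have hbe : b < e := by
    by_contra! h
    exact hw' e g r 0 0 h (by omega) (by linarith)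
  -- Subtracting the two relations compares (q+g)z with (β-e)y. For p < r, (q+g)z is in x + G; for p
  -- > r, (β-e)y is, against minimality of β. For p = r they are equal, and replacing (q+g)z by the
  -- longer sum (β-e)y lengthens by + cz past s, so `hred` applies.
  have hcq : c < q + g := by
    by_contra! h
    obtain ⟨d, rfl⟩ := Nat.exists_eq_add_of_le heβ
    rcases lt_trichotomy p r with hpr | rfl | hpr
    · obtain ⟨l, rfl⟩ := Nat.exists_eq_add_of_lt hpr
      exact hw' 0 (q + g) l d 0 (by omega) h (by linarith)
    · have hd : (q + g) * z = d * y := by linarith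
      have hlt : q + g < d := by
        by_contra! hle
        have h1 : (q + g) * y < (q + g) * z := Nat.mul_lt_mul_of_pos_left hyz (by omega)
        have h2 := Nat.mul_le_mul_right y hle
        omega
      obtain ⟨m, rfl⟩ := Nat.exists_eq_add_of_le h
      by_cases hm : m ≤ s + 1
      · obtain ⟨t, ht⟩ := Nat.exists_eq_add_of_le hm
        obtain ⟨l, hl⟩ := Nat.exists_eq_add_of_le (show t ≤ b + d by omega)
        obtain ⟨u, v, w, h1, -⟩ := hred t m (by omega)
        refine hw u (v + l) w ?_
        have h3 : b * y + d * y = t * y + l * y := by rw [← add_mul, hl, add_mul]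
        linarith
      · omega
    · obtain ⟨l, rfl⟩ := Nat.exists_eq_add_of_lt hpr
      have := hmin d l 0 (q + g) (by linarith)
      omega
  obtain ⟨i, hi⟩ := Nat.exists_eq_add_of_le (show g ≤ k + 1 by omega)
  obtain ⟨g, rfl⟩ := Nat.exists_eq_add_of_le' hg1
  -- Here `g` has been shifted down by one: the least coefficient is now `g + 1`, and i = k - g ≥ 1.
  -- The bounds on b and c give i ≤ q and i < b.
  obtain ⟨f₁, f₂, f₃, h1, h2⟩ := hred (β + i) g (by omega)
  by_cases hf : i ≤ f₂
  · obtain ⟨d, rfl⟩ := Nat.exists_eq_add_of_le hf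
    by_cases hf3 : g ≤ f₃
    · obtain ⟨m, rfl⟩ := Nat.exists_eq_add_of_le hf3
      have := hbad f₁ d m (by linarith)
      omega
    · obtain ⟨m, rfl⟩ := Nat.exists_eq_add_of_lt (not_le.mp hf3)
      by_cases hd : β ≤ d
      · obtain ⟨l, rfl⟩ := Nat.exists_eq_add_of_le hd
        exact hw' 0 (m + 1) f₁ l 0 (by omega) (by omega) (by linarith)
      · obtain ⟨l, rfl⟩ := Nat.exists_eq_add_of_le (not_le.mp hd).le
        exact hgmin (m + 1) (by omega)
          ⟨by omega, by omega, l, f₁, by omega, by omega, by linarith⟩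
  -- Now j = i - f₂ ≥ 1, and substituting the relation for βy leaves an identity between jy,
  -- multiples of x and multiples of z.
  · obtain ⟨j, rfl⟩ := Nat.exists_eq_add_of_le (not_le.mp hf).le
    by_cases hfp : p < f₁
    · obtain ⟨v, rfl⟩ := Nat.exists_eq_add_of_lt hfp
      by_cases hf3 : q + g ≤ f₃
      · obtain ⟨m, rfl⟩ := Nat.exists_eq_add_of_le hf3
        have := hmin j v 0 m (by linarith)
        omega
      · obtain ⟨h, hh⟩ := Nat.exists_eq_add_of_le (not_le.mp hf3).le
        have hh' : q * z + g * z = f₃ * z + h * z := by rw [← add_mul, hh, add_mul]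
        have hv : (v + 1) * x = j * y + h * z := by linarith
        by_cases hhg : h ≤ g + 1
        · exact hw' j h v 0 0 (by omega) (by omega) (by linarith)
        · obtain ⟨t, rfl⟩ := Nat.exists_eq_add_of_le (not_le.mp hhg).le
          obtain ⟨d, rfl⟩ := Nat.exists_eq_add_of_le (show j ≤ e by omega)
          by_cases hvr : v < r
          · obtain ⟨l, rfl⟩ := Nat.exists_eq_add_of_lt hvr
            have := hmin d l 0 t (by linarith)
            omega
          · obtain ⟨l, rfl⟩ := Nat.exists_eq_add_of_le (not_lt.mp hvr)
            obtain ⟨a, rfl⟩ := Nat.exists_eq_add_of_le (show d ≤ β by omega)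
            obtain rfl : q = f₃ + t + 1 := by omega
            have := hmin a (p + l) 0 (f₃ + 1) (by linarith)
            omega
    · obtain ⟨v, rfl⟩ := Nat.exists_eq_add_of_le (not_lt.mp hfp)
      -- As z is the largest generator, f₃ is at most the length of the right side. With s ≤ f₁ + f₂
      -- + f₃ this yields β ≤ p + q + 1, against `hpq`.
      have h3 : f₃ * z = v * x + j * y + (q + g) * z := by linarith
      have hlt : f₃ ≤ v + j + (q + g) := by
        by_contra! hlt
        have h4 := Nat.mul_lt_mul_of_pos_right hlt (show 0 < z by omega)
        have h5 : v * x ≤ v * z := Nat.mul_le_mul_left v (by omega)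
        have h6 : j * y ≤ j * z := Nat.mul_le_mul_left j (by omega)
        linarith
      omega

/-- A long enough representation of the least multiple βy extends to by by adding b - β copies of y;
`order_core` rules out the absence of one. Minimality of β lets y be cancelled from the right side.
-/
theorem order_multiple {x y z s b₀ c₀ : ℕ} (hx : 0 < x) (hxy : x < y) (hyz : y < z)
    (hred : ∀ b c, b + c = s + 1 →
      ∃ u v w, (u + 1) * x + v * y + w * z = b * y + c * z ∧ s ≤ u + v + w)
    (hbc : b₀ + c₀ = s) (hw : ∀ u v w, b₀ * y + c₀ * z ≠ (u + 1) * x + v * y + w * z)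
    {b u₀ v₀ w₀ : ℕ} (hb : b * y = (u₀ + 1) * x + v₀ * y + w₀ * z) :
    ∃ u v w, b * y = (u + 1) * x + v * y + w * z ∧ b ≤ u + v + w + 1 := by
  classical
  have hex : ∃ β u v w, β * y = (u + 1) * x + v * y + w * z := ⟨b, u₀, v₀, w₀, hb⟩
  have hmin : ∀ b u v w, b * y = (u + 1) * x + v * y + w * z → Nat.find hex ≤ b :=
    fun b u v w h => Nat.find_min' hex ⟨u, v, w, h⟩
  obtain ⟨p, v, q, hβ⟩ := Nat.find_spec hex
  generalize Nat.find hex = β at *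
  by_cases hgood : ∃ u v w, β * y = (u + 1) * x + v * y + w * z ∧ β ≤ u + v + w + 1
  · obtain ⟨u, v, w, h1, h2⟩ := hgood
    obtain ⟨d, rfl⟩ := Nat.exists_eq_add_of_le (hmin _ _ _ _ hb)
    exact ⟨u, v + d, w, by linarith, by omega⟩
  · push Not at hgood
    have hvβ : v ≤ β := by
      by_contra! h
      have := Nat.mul_le_mul_right y h.le
      have : 0 < (p + 1) * x := by positivity
      omega
    obtain ⟨d, rfl⟩ := Nat.exists_eq_add_of_le hvβ
    have := hmin d p 0 q (by linarith)
    obtain rfl : v = 0 := by omega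
    exact (order_core (p := p) (q := q) hx hxy hyz (by linarith) hmin hgood hred hbc hw).elim

/-- Cancel every generator common to both sides. If only z remains on the left, or only x on the
right with y and z on the left, comparing sizes suffices. What remains is a pure multiple of y, the
case of `order_multiple`. -/
theorem order_add_smallest {x y z s b₀ c₀ : ℕ} (hx : 0 < x) (hxy : x < y) (hyz : y < z)
    (hred : ∀ b c, b + c = s + 1 →
      ∃ u v w, (u + 1) * x + v * y + w * z = b * y + c * z ∧ s ≤ u + v + w)
    (hbc : b₀ + c₀ = s) (hw : ∀ u v w, b₀ * y + c₀ * z ≠ (u + 1) * x + v * y + w * z)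
    (b₁ b₂ b₃ a₁ a₂ a₃ : ℕ)
    (hab : b₁ * x + b₂ * y + b₃ * z = (a₁ + 1) * x + a₂ * y + a₃ * z) :
    ∃ u v w, u * x + v * y + w * z = a₁ * x + a₂ * y + a₃ * z ∧
      b₁ + b₂ + b₃ ≤ u + v + w + 1 := by
  rcases Nat.eq_zero_or_pos b₁ with rfl | hb1
  swap
  · obtain ⟨b, rfl⟩ := Nat.exists_eq_add_of_le' hb1
    exact ⟨b, b₂, b₃, by linarith, by omega⟩
  induction b₂ generalizing a₂ with
  | zero =>
    refine ⟨a₁, a₂, a₃, rfl, ?_⟩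
    by_contra! h
    have h1 := Nat.mul_le_mul_right z (show a₁ + 1 + a₂ + a₃ + 1 ≤ b₃ by omega)
    have h2 : (a₁ + 1) * x ≤ (a₁ + 1) * z := Nat.mul_le_mul_left _ (by omega)
    have h3 : a₂ * y ≤ a₂ * z := Nat.mul_le_mul_left _ (by omega)
    linarith
  | succ b₂ ih =>
    rcases a₂ with _ | a₂
    · clear ih
      induction b₃ generalizing a₃ with
      | zero =>
        obtain ⟨u, v, w, h1, h2⟩ := order_multiple hx hxy hyz hred hbc hw
          (b := b₂ + 1) (u₀ := a₁) (v₀ := 0) (w₀ := a₃) (by linarith)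
        exact ⟨u, v, w, by linarith, by omega⟩
      | succ b₃ ih =>
        rcases a₃ with _ | a₃
        · refine ⟨a₁, 0, 0, rfl, ?_⟩
          by_contra! h
          have h1 := Nat.mul_le_mul_right x (show a₁ + 1 ≤ b₂ + 1 + (b₃ + 1) by omega)
          have h2 : (b₂ + 1) * x < (b₂ + 1) * y := Nat.mul_lt_mul_of_pos_left hxy (by omega)
          have h3 : (b₃ + 1) * x ≤ (b₃ + 1) * z := Nat.mul_le_mul_left _ (by omega)
          linarith
        · obtain ⟨u, v, w, h1, h2⟩ := ih a₃ (by linarith)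
          exact ⟨u, v, w + 1, by linarith, by omega⟩
    · obtain ⟨u, v, w, h1, h2⟩ := ih a₂ (by linarith)
      exact ⟨u, v + 1, w, by linarith, by omega⟩

end NumericalSemigroupRing

/-! ### Cohen–Macaulayness of finite torsion-free algebras over a PID -/

namespace TangentCone

theorem ringKrullDim_le_of_isIntegral (B A : Type*) [CommRing B] [CommRing A] [Algebra B A]
    [Algebra.IsIntegral B A] : ringKrullDim A ≤ ringKrullDim B := by
  refine Order.krullDim_le_of_strictMono (PrimeSpectrum.comap (algebraMap B A)) ?_
  intro p q hpq
  obtain ⟨hle, x, hxq, hxp⟩ := SetLike.lt_iff_le_and_exists.mp (show p.asIdeal < q.asIdeal from hpq)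
  exact Ideal.comap_lt_comap_of_integral_mem_sdiff (I := p.asIdeal) (J := q.asIdeal) hle
    ⟨hxq, hxp⟩ (Algebra.IsIntegral.isIntegral x)

/-- By incomparability a prime over 0 is minimal, and the empty sequence works. Any other prime
contains the image of a nonzero b, a nonzerodivisor, so its height is positive; it is at most dim B
= 1, and this single element is the regular sequence. -/
theorem isCohenMacaulay_of_finite_of_torsionFree (B A : Type*) [CommRing B] [IsDomain B]
    [IsPrincipalIdealRing B] (hB : ¬ IsField B) [CommRing A] [Algebra B A] [Module.Finite B A]
    (hA : ∀ (b : B) (a : A), b ≠ 0 → algebraMap B A b * a = 0 → a = 0) :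
    IsCohenMacaulay A := by
  have : Algebra.IsIntegral B A := Algebra.IsIntegral.of_finite B A
  have hnoeth : IsNoetherianRing A := IsNoetherianRing.of_finite B A
  refine ⟨hnoeth, fun p hp => ⟨IsLocalization.isNoetherianRing p.primeCompl _ hnoeth, ?_⟩⟩
  have hdim := IsLocalization.AtPrime.ringKrullDim_eq_height p (Localization.AtPrime p)
  by_cases hq : p.comap (algebraMap B A) = ⊥
  · refine ⟨[], by simp, RingTheory.Sequence.IsRegular.nil _ _, ?_⟩
    have hmin : p ∈ minimalPrimes A := by
      refine ⟨⟨hp, bot_le⟩, fun q hq' hle => ?_⟩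
      have := hq'.1
      by_contra hnle
      obtain ⟨x, hxp, hxq⟩ := SetLike.not_le_iff_exists.mp hnle
      have := Ideal.comap_lt_comap_of_integral_mem_sdiff (R := B) hle ⟨hxp, hxq⟩
        (Algebra.IsIntegral.isIntegral x)
      rw [hq] at this
      exact not_lt_bot this
    rw [hdim, Ideal.height_eq_zero_iff.mpr hmin]
    simp
  · obtain ⟨b, hbp, hb⟩ := Submodule.exists_mem_ne_zero_of_ne_bot hq
    have hreg : algebraMap B A b ∈ nonZeroDivisors A :=
      mem_nonZeroDivisors_iff_left.mpr fun a => hA b a hb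
    have hmem : algebraMap A (Localization.AtPrime p) (algebraMap B A b) ∈
        IsLocalRing.maximalIdeal (Localization.AtPrime p) :=
      (IsLocalization.AtPrime.to_map_mem_maximal_iff _ p _).mpr hbp
    refine ⟨[algebraMap A _ (algebraMap B A b)], by simpa using hmem, ⟨?_, ?_⟩, ?_⟩
    · rw [RingTheory.Sequence.isWeaklyRegular_singleton_iff]
      have := IsLocalization.map_nonZeroDivisors_le p.primeCompl (Localization.AtPrime p)
        ⟨_, hreg, rfl⟩
      intro x y hxy
      exact (mul_cancel_left_mem_nonZeroDivisors this).mp hxy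
    · intro h
      rw [Ideal.ofList_singleton, smul_eq_mul, Ideal.mul_top] at h
      exact (IsLocalRing.maximalIdeal.isMaximal _).ne_top
        (top_le_iff.mp (h.trans_le ((Ideal.span_singleton_le_iff_mem _).mpr hmem)))
    · rw [hdim]
      have h1 : p.height ≠ 0 := fun h =>
        notMem_nonZeroDivisors_of_mem_mem_minimalPrimes (q := p) hbp
          (Ideal.height_eq_zero_iff.mp h) hreg
      have h2 : (p.height : WithBot ℕ∞) ≤ 1 :=
        (Ideal.height_le_ringKrullDim_of_ne_top hp.ne_top).trans
          ((ringKrullDim_le_of_isIntegral B A).trans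
            (IsPrincipalIdealRing.ringKrullDim_eq_one B hB).le)
      have h3 : p.height = 1 :=
        le_antisymm (by exact_mod_cast h2) (Order.one_le_iff_ne_zero.mpr h1)
      simp [h3]

end TangentCone

/-! ### The associated graded ring as a k[X]-algebra -/

namespace TangentCone

open Polynomial

variable {R : Type*} [CommRing R]

theorem mem_map_algebraMap_reesAlgebra_iff (I : Ideal R) (F : reesAlgebra I) :
    F ∈ I.map (algebraMap R (reesAlgebra I)) ↔ ∀ i, (F : R[X]).coeff i ∈ I ^ (i + 1) := by
  constructor
  · intro hF
    refine Submodule.span_induction ?_ ?_ ?_ ?_ hF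
    · rintro _ ⟨a, ha, rfl⟩ i
      change (C a : R[X]).coeff i ∈ _
      rw [coeff_C]
      split_ifs with h
      · simpa [h] using ha
      · exact zero_mem _
    · intro i
      simp
    · intro F G _ _ hF hG i
      simpa using add_mem (hF i) (hG i)
    · intro G F _ hF i
      rw [smul_eq_mul, Subalgebra.coe_mul, coeff_mul]
      refine sum_mem fun p hp => ?_
      rw [← Finset.HasAntidiagonal.mem_antidiagonal.mp hp, add_assoc, pow_add]
      exact Ideal.mul_mem_mul (G.2 _) (hF _)
  · intro hF
    have key : ∀ i, ∀ c ∈ I ^ (i + 1), ∃ G ∈ I.map (algebraMap R (reesAlgebra I)),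
        (G : R[X]) = monomial i c := by
      intro i c hc
      rw [pow_succ'] at hc
      refine Submodule.mul_induction_on hc ?_ ?_
      · intro a ha b hb
        refine ⟨algebraMap R _ a * ⟨monomial i b, reesAlgebra.monomial_mem.mpr hb⟩,
          Ideal.mul_mem_right _ _ (Ideal.mem_map_of_mem _ ha), ?_⟩
        change C a * monomial i b = _
        rw [C_mul_monomial]
      · rintro a b ⟨G, hG, hGa⟩ ⟨H, hH, hHb⟩
        exact ⟨G + H, add_mem hG hH, by simp [hGa, hHb]⟩
    choose G hG hGF using fun i => key i _ (hF i)
    have : F = ∑ i ∈ (F : R[X]).support, G i := by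
      apply Subtype.ext
      rw [AddSubmonoidClass.coe_finsetSum]
      simp_rw [hGF]
      exact as_sum_support _
    rw [this]
    exact sum_mem fun i _ => hG i

/-- The inclusion of `Iⁱ` as the degree `i` part of the Rees algebra. -/
noncomputable def reesMonomial (I : Ideal R) (i : ℕ) : ↥(I ^ i) →ₗ[R] reesAlgebra I where
  toFun c := ⟨monomial i (c : R), reesAlgebra.monomial_mem.mpr c.2⟩
  map_add' a b := Subtype.ext (by simp)
  map_smul' a b := Subtype.ext (by simp [smul_monomial])

theorem eq_sum_reesMonomial (I : Ideal R) (F : reesAlgebra I) :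
    F = ∑ i ∈ (F : R[X]).support, reesMonomial I i ⟨(F : R[X]).coeff i, F.2 i⟩ := by
  apply Subtype.ext
  rw [AddSubmonoidClass.coe_finsetSum]
  exact as_sum_support _

/-- The map `k[X] → R[It]` sending `X` to `xt`. -/
noncomputable def polynomialToRees (k : Type*) [Field k] [Algebra k R] {I : Ideal R} {x : R} (hx : x ∈ I) :
    k[X] →+* reesAlgebra I :=
  eval₂RingHom ((algebraMap R (reesAlgebra I)).comp (algebraMap k R))
    (reesMonomial I 1 ⟨x, by simpa using hx⟩)

/-- The map `k[X] → gr_I(R)` sending `X` to the class of `xt`. -/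
noncomputable def polynomialToGraded (k : Type*) [Field k] [Algebra k R] {I : Ideal R} {x : R}
    (hx : x ∈ I) : k[X] →+* associatedGraded I :=
  (Ideal.Quotient.mk (I.map (algebraMap R (reesAlgebra I)))).comp (polynomialToRees k hx)

section

variable {k : Type*} [Field k] [Algebra k R] {I : Ideal R} {x : R} (hx : x ∈ I)

theorem coeff_polynomialToRees (P : k[X]) (j : ℕ) :
    (polynomialToRees k hx P : R[X]).coeff j = algebraMap k R (P.coeff j) * x ^ j := by
  induction P using Polynomial.induction_on' with
  | add P Q hP hQ => simp [hP, hQ, add_mul]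
  | monomial m c =>
    have : (polynomialToRees k hx (monomial m c) : R[X]) = monomial m (algebraMap k R c * x ^ m) := by
      simp only [polynomialToRees, coe_eval₂RingHom, eval₂_monomial]
      change C (algebraMap k R c) * (monomial 1 x) ^ m = _
      rw [monomial_pow, C_mul_monomial, one_mul]
    rw [this, coeff_monomial, coeff_monomial]
    split_ifs with h
    · rw [h]
    · simp

/-- The lowest term of P decides. By strong induction on the degree, the other terms contributing to
the relevant coefficient of the product already lie in the higher power of I, so a unit times a
power of x can be cancelled by `hreg`. -/
theorem associatedGraded_torsionFree (hreg : ∀ i f, x * f ∈ I ^ (i + 1) → f ∈ I ^ i)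
    {P : k[X]} (hP : P ≠ 0) {F : reesAlgebra I}
    (h : polynomialToRees k hx P * F ∈ I.map (algebraMap R (reesAlgebra I))) :
    F ∈ I.map (algebraMap R (reesAlgebra I)) := by
  rw [mem_map_algebraMap_reesAlgebra_iff] at h ⊢
  have hreg' : ∀ j i f, x ^ j * f ∈ I ^ (i + j) → f ∈ I ^ i := by
    intro j
    induction j with
    | zero => intro i f hf; simpa using hf
    | succ j ih =>
      intro i f hf
      refine ih i f (hreg _ _ ?_)
      rwa [← mul_assoc, ← pow_succ', add_assoc]
  intro i
  induction i using Nat.strong_induction_on with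
  | _ i ih =>
    have h1 := h (P.natTrailingDegree + i)
    rw [Subalgebra.coe_mul, coeff_mul, ← Finset.add_sum_erase _ _
      (Finset.HasAntidiagonal.mem_antidiagonal.mpr
        (rfl : (P.natTrailingDegree, i).1 + (P.natTrailingDegree, i).2 = _))] at h1
    have h2 : ∑ p ∈ (Finset.HasAntidiagonal.antidiagonal (P.natTrailingDegree + i)).erase
        (P.natTrailingDegree, i), (polynomialToRees k hx P : R[X]).coeff p.1 * (F : R[X]).coeff p.2
        ∈ I ^ (P.natTrailingDegree + i + 1) := by
      refine sum_mem ?_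
      rintro ⟨a, b⟩ hab
      simp only [Finset.mem_erase, Finset.HasAntidiagonal.mem_antidiagonal, ne_eq, Prod.mk.injEq] at hab
      rw [coeff_polynomialToRees]
      rcases lt_or_ge a P.natTrailingDegree with ha | ha
      · simp [coeff_eq_zero_of_lt_natTrailingDegree ha]
      · rw [← hab.2, add_assoc, pow_add]
        exact Ideal.mul_mem_mul (Ideal.mul_mem_left _ _ (Ideal.pow_mem_pow hx _))
          (ih b (by omega))
    have h3 := (Submodule.add_mem_iff_left _ h2).mp h1
    simp only [coeff_polynomialToRees] at h3
    have h4 := Ideal.mul_mem_left _ (algebraMap k R (P.coeff P.natTrailingDegree)⁻¹) h3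
    rw [← mul_assoc, ← mul_assoc, ← map_mul, inv_mul_cancel₀, map_one, one_mul] at h4
    · exact hreg' P.natTrailingDegree _ _ (by convert h4 using 2; ring)
    · simpa using hP

/-- Beyond degree r each graded piece is X times the previous one. The pieces up to r are finitely
generated over R, which acts through k because R = k + I. -/
theorem polynomialToGraded_finite (hfg : I.FG)
    (hk : ∀ f : R, ∃ c : k, f - algebraMap k R c ∈ I) {r : ℕ}
    (hred : I ^ (r + 1) = Ideal.span {x} * I ^ r) :
    RingHom.Finite (A := k[X]) (B := associatedGraded I) (polynomialToGraded k hx) := by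
  let φ := polynomialToGraded k hx
  let : Algebra k[X] (associatedGraded I) :=
    RingHom.toAlgebra (R := k[X]) (S := associatedGraded I) φ
  change Module.Finite k[X] (associatedGraded I)
  have hsmul (P : k[X]) (a : associatedGraded I) : P • a = φ P * a := rfl
  have hsmulR : ∀ (a : R) (W : Submodule k[X] (associatedGraded I)), ∀ w ∈ W, a • w ∈ W := by
    intro a W w hw
    obtain ⟨c, hc⟩ := hk a
    have : a • w = C c • w := by
      rw [hsmul]
      refine (Algebra.smul_def (A := associatedGraded I) a w).trans (congrArg (· * w) ?_)
      rw [← sub_eq_zero]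
      have h1 : φ (C c) = algebraMap R _ (algebraMap k R c) := by
        simp [φ, polynomialToGraded, polynomialToRees]
      rw [h1, ← map_sub]
      exact Ideal.Quotient.eq_zero_iff_mem.mpr (Ideal.mem_map_of_mem _ hc)
    rw [this]
    exact W.smul_mem _ hw
  let L (i : ℕ) : ↥(I ^ i) →ₗ[R] associatedGraded I :=
    (Ideal.Quotient.mkₐ R (I.map (algebraMap R (reesAlgebra I)))).toLinearMap ∘ₗ reesMonomial I i
  have hT : ∀ i, ∃ T : Finset (associatedGraded I), Submodule.span R (T : Set _) =
      LinearMap.range (L i) := by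
    intro i
    have : Module.Finite R ↥(I ^ i) := Module.Finite.iff_fg.mpr (hfg.pow)
    exact Module.Finite.iff_fg.mp (inferInstance : Module.Finite R (LinearMap.range (L i)))
  choose T hT using hT
  classical
  let W : Submodule k[X] (associatedGraded I) :=
    Submodule.span k[X] ((Finset.range (r + 1)).biUnion T : Finset (associatedGraded I))
  have hred' : ∀ i, r ≤ i → I ^ (i + 1) = Ideal.span {x} * I ^ i := by
    intro i hi
    obtain ⟨d, rfl⟩ := Nat.exists_eq_add_of_le hi
    rw [show r + d + 1 = r + 1 + d by ring, pow_add, hred, mul_assoc, ← pow_add]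
  have hLr : ∀ i ≤ r, ∀ c, L i c ∈ W := by
    intro i hi c
    have : L i c ∈ Submodule.span R (T i : Set (associatedGraded I)) := by
      rw [hT]
      exact ⟨c, rfl⟩
    refine Submodule.span_induction ?_ (zero_mem _) (fun _ _ _ _ => add_mem)
      (fun a w _ hw => hsmulR a W w hw) this
    exact fun w hw => Submodule.subset_span
      (Finset.mem_biUnion.mpr ⟨i, Finset.mem_range.mpr (by omega), hw⟩)
  have hL : ∀ i c, L i c ∈ W := by
    intro i
    induction i with
    | zero => exact hLr 0 (Nat.zero_le r)
    | succ i ih =>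
      rcases le_or_gt (i + 1) r with hi | hi
      · exact hLr _ hi
      rintro ⟨c, hc⟩
      have hc' := hc
      rw [hred' i (by omega), Ideal.mem_span_singleton_mul] at hc'
      obtain ⟨d, hd, rfl⟩ := hc'
      have : L (i + 1) ⟨x * d, hc⟩ = (X : k[X]) • L i ⟨d, hd⟩ := by
        rw [hsmul]
        simp only [φ, polynomialToGraded, RingHom.comp_apply, polynomialToRees, coe_eval₂RingHom,
          eval₂_X]
        change Ideal.Quotient.mk _ _ = Ideal.Quotient.mk _ _ * Ideal.Quotient.mk _ _
        rw [← map_mul]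
        congr 1
        apply Subtype.ext
        change monomial (i + 1) (x * d) = monomial 1 x * monomial i d
        rw [monomial_mul_monomial, add_comm]
      rw [this]
      exact W.smul_mem _ (ih _)
  have hW : W = ⊤ := by
    refine eq_top_iff.mpr ?_
    rintro a -
    obtain ⟨F, rfl⟩ := Ideal.Quotient.mk_surjective a
    rw [eq_sum_reesMonomial I F, map_sum]
    exact sum_mem fun i _ => hL i _
  have hfgW : W.FG := Submodule.fg_span (Finset.finite_toSet _)
  rw [hW] at hfgW
  exact Module.finite_def.mpr hfgW

end

theorem isCohenMacaulay_associatedGraded (k : Type*) [Field k] [Algebra k R] {I : Ideal R} {x : R}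
    (hx : x ∈ I) (hfg : I.FG)
    (hk : ∀ f : R, ∃ c : k, f - algebraMap k R c ∈ I) {r : ℕ}
    (hred : I ^ (r + 1) = Ideal.span {x} * I ^ r)
    (hreg : ∀ i f, x * f ∈ I ^ (i + 1) → f ∈ I ^ i) :
    IsCohenMacaulay (associatedGraded I) := by
  let : Algebra k[X] (associatedGraded I) :=
    RingHom.toAlgebra (R := k[X]) (S := associatedGraded I) (polynomialToGraded k hx)
  have : Module.Finite k[X] (associatedGraded I) :=
    polynomialToGraded_finite hx hfg hk hred
  refine isCohenMacaulay_of_finite_of_torsionFree k[X] (associatedGraded I)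
    (Polynomial.not_isField k) ?_
  intro P a hP ha
  obtain ⟨F, rfl⟩ := Ideal.Quotient.mk_surjective a
  refine Ideal.Quotient.eq_zero_iff_mem.mpr (associatedGraded_torsionFree hx hreg hP ?_)
  rw [← Ideal.Quotient.eq_zero_iff_mem, map_mul]
  exact ha

end TangentCone

namespace TangentCone

theorem not_pow_nilpotencyIndex_le {R : Type*} [CommRing R] {Q I : Ideal R} (hQ : Q ≠ ⊤) :
    ¬ I ^ nilpotencyIndex Q I ≤ Q := by
  intro h
  rcases hs : nilpotencyIndex Q I with _ | s
  · rw [hs, pow_zero, Ideal.one_eq_top, top_le_iff] at h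
    exact hQ h
  · rw [hs] at h
    exact Nat.notMem_of_lt_sInf (s := {s | I ^ (s + 1) ≤ Q}) (m := s)
      (s.lt_succ_self.trans_eq hs.symm) h

end TangentCone

/-! ### Powers of the maximal ideal in terms of orders of exponents -/

namespace NumericalSemigroupRing

/-- The element `a` of the semigroup is a sum of at least `i` generators. -/
def HasOrder {d : ℕ} (n : Fin d → ℕ) (i a : ℕ) : Prop :=
  ∃ u : Fin d → ℕ, i ≤ ∑ j, u j ∧ ∑ j, u j * n j = a

section

variable {d : ℕ} {n : Fin d → ℕ}

theorem hasOrder_zero_iff {a : ℕ} : HasOrder n 0 a ↔ a ∈ semigroup n := by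
  rw [mem_semigroup_iff]
  constructor
  · rintro ⟨u, -, h⟩
    exact ⟨Finsupp.equivFunOnFinite.symm u, by simpa using h⟩
  · rintro ⟨e, h⟩
    exact ⟨e, Nat.zero_le _, h⟩

theorem HasOrder.mem_semigroup {i a : ℕ} (h : HasOrder n i a) : a ∈ semigroup n := by
  obtain ⟨u, -, h⟩ := h
  exact hasOrder_zero_iff.mp ⟨u, Nat.zero_le _, h⟩

theorem HasOrder.add {i j a b : ℕ} (ha : HasOrder n i a) (hb : HasOrder n j b) :
    HasOrder n (i + j) (a + b) := by
  obtain ⟨u, hu, rfl⟩ := ha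
  obtain ⟨v, hv, rfl⟩ := hb
  refine ⟨u + v, ?_, ?_⟩
  · simpa [Finset.sum_add_distrib] using add_le_add hu hv
  · simp [Finset.sum_add_distrib, add_mul]

theorem hasOrder_gen (j : Fin d) : HasOrder n 1 (n j) :=
  ⟨Pi.single j 1, by simp, by simp [Pi.single_apply]⟩

theorem HasOrder.exists_gen {i a : ℕ} (h : HasOrder n (i + 1) a) :
    ∃ j b, a = n j + b ∧ HasOrder n i b := by
  obtain ⟨u, hu, rfl⟩ := h
  obtain ⟨j, -, hj⟩ := Finset.exists_ne_zero_of_sum_ne_zero (show ∑ j, u j ≠ 0 by omega)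
  obtain ⟨v, rfl⟩ : ∃ v : Fin d → ℕ, u = Pi.single j 1 + v := by
    refine ⟨u - Pi.single j 1, (add_tsub_cancel_of_le ?_).symm⟩
    intro l
    rcases eq_or_ne l j with rfl | hl
    · simpa using Nat.one_le_iff_ne_zero.mpr hj
    · simp [hl]
  refine ⟨j, ∑ l, v l * n l, ?_, v, ?_, rfl⟩
  · simp [add_mul, Finset.sum_add_distrib, Pi.single_apply]
  · simp only [Pi.add_apply, Finset.sum_add_distrib, Finset.sum_pi_single', Finset.mem_univ,
      if_true] at hu
    omega

variable (k : Type*) [Field k]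

/-- The ideal of the power series in `R` all of whose exponents are sums of at least `i`
generators. -/
def orderIdeal (n : Fin d → ℕ) (i : ℕ) : Ideal (ring k n) where
  carrier := {f | ∀ a, PowerSeries.coeff a (f : k⟦X⟧) ≠ 0 → HasOrder n i a}
  add_mem' := by
    intro f g hf hg a ha
    by_cases h : PowerSeries.coeff a (f : k⟦X⟧) = 0
    · exact hg a (by simpa [h] using ha)
    · exact hf a h
  zero_mem' := by
    intro a ha
    simp at ha
  smul_mem' := by
    intro f g hg a ha
    rw [smul_eq_mul, Subalgebra.coe_mul, PowerSeries.coeff_mul] at ha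
    obtain ⟨p, hp, hne⟩ := Finset.exists_ne_zero_of_sum_ne_zero ha
    rw [← Finset.HasAntidiagonal.mem_antidiagonal.mp hp, ← zero_add i]
    exact (hasOrder_zero_iff.mpr (f.2 _ (left_ne_zero_of_mul hne))).add
      (hg _ (right_ne_zero_of_mul hne))

variable {k}

theorem mem_orderIdeal {i : ℕ} {f : ring k n} :
    f ∈ orderIdeal k n i ↔ ∀ a, PowerSeries.coeff a (f : k⟦X⟧) ≠ 0 → HasOrder n i a := Iff.rfl

theorem orderIdeal_zero : orderIdeal k n 0 = ⊤ :=
  eq_top_iff.mpr fun f _ a ha => hasOrder_zero_iff.mpr (f.2 a ha)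

theorem gen_mem_orderIdeal (j : Fin d) : gen k n j ∈ orderIdeal k n 1 := by
  intro a ha
  have h : a = n j := by
    by_contra hne
    exact ha ((PowerSeries.coeff_X_pow _ _).trans (if_neg hne))
  exact h ▸ hasOrder_gen j

theorem maxIdeal_mul_orderIdeal_le (i : ℕ) :
    maxIdeal k n * orderIdeal k n i ≤ orderIdeal k n (i + 1) := by
  have hm : maxIdeal k n ≤ orderIdeal k n 1 :=
    Ideal.span_le.mpr (by rintro _ ⟨j, rfl⟩; exact gen_mem_orderIdeal j)
  refine Ideal.mul_le.mpr fun f hf g hg a ha => ?_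
  rw [Subalgebra.coe_mul, PowerSeries.coeff_mul] at ha
  obtain ⟨p, hp, hne⟩ := Finset.exists_ne_zero_of_sum_ne_zero ha
  rw [← Finset.HasAntidiagonal.mem_antidiagonal.mp hp, add_comm i]
  exact (hm hf _ (left_ne_zero_of_mul hne)).add (hg _ (right_ne_zero_of_mul hne))

/-- Choose for each exponent of f one generator to split off, and group the terms of f by that
choice. This writes the whole series as a finite sum of the t^{n_l} times series of order at least
i. -/
theorem orderIdeal_succ_le (i : ℕ) :
    orderIdeal k n (i + 1) ≤ maxIdeal k n * orderIdeal k n i := by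
  classical
  intro f hf
  rcases isEmpty_or_nonempty (Fin d) with hd | hd
  · have : f = 0 := by
      apply Subtype.ext
      ext a
      by_contra ha
      obtain ⟨j, -⟩ := (hf a ha).exists_gen
      exact hd.elim j
    rw [this]
    exact zero_mem _
  choose! j b hb using fun a ha => (hf a ha).exists_gen
  let g (l : Fin d) : k⟦X⟧ := PowerSeries.mk fun c =>
    if j (n l + c) = l then PowerSeries.coeff (n l + c) (f : k⟦X⟧) else 0
  have hg : ∀ l c, PowerSeries.coeff c (g l) ≠ 0 → HasOrder n i c := by
    intro l c hc
    simp only [g, PowerSeries.coeff_mk, ne_eq, ite_eq_right_iff, Classical.not_imp] at hc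
    obtain ⟨h1, h2⟩ := hb _ hc.2
    rw [hc.1] at h1
    rwa [← Nat.add_left_cancel h1] at h2
  let g' (l : Fin d) : ring k n := ⟨g l, fun c hc => (hg l c hc).mem_semigroup⟩
  have hf' : f = ∑ l, gen k n l * g' l := by
    apply Subtype.ext
    rw [AddSubmonoidClass.coe_finsetSum]
    ext a
    rw [map_sum]
    have hterm : ∀ l, PowerSeries.coeff a ((gen k n l * g' l : ring k n) : k⟦X⟧) =
        if n l ≤ a ∧ j a = l then PowerSeries.coeff a (f : k⟦X⟧) else 0 := by
      intro l
      change PowerSeries.coeff a (PowerSeries.X ^ n l * g l) = _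
      rw [PowerSeries.coeff_X_pow_mul']
      by_cases hl : n l ≤ a
      · simp [g, hl, Nat.add_sub_cancel' hl]
      · simp [hl]
    simp_rw [hterm]
    by_cases ha : PowerSeries.coeff a (f : k⟦X⟧) = 0
    · simp [ha]
    · have hle : n (j a) ≤ a := by
        have := (hb a ha).1
        omega
      rw [Finset.sum_eq_single (j a)]
      · simp [hle]
      · intro l _ hl
        exact if_neg fun h => hl h.2.symm
      · simp
  rw [hf']
  exact sum_mem fun l _ => Ideal.mul_mem_mul (Ideal.subset_span ⟨l, rfl⟩) (hg l)

theorem maxIdeal_pow (i : ℕ) : maxIdeal k n ^ i = orderIdeal k n i := by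
  induction i with
  | zero => rw [pow_zero, Ideal.one_eq_top, orderIdeal_zero]
  | succ i ih =>
    rw [pow_succ', ih]
    exact le_antisymm (maxIdeal_mul_orderIdeal_le i) (orderIdeal_succ_le i)

theorem mem_maxIdeal_pow {i : ℕ} {f : ring k n} :
    f ∈ maxIdeal k n ^ i ↔ ∀ a, PowerSeries.coeff a (f : k⟦X⟧) ≠ 0 → HasOrder n i a := by
  rw [maxIdeal_pow, mem_orderIdeal]

theorem exists_sub_algebraMap_mem_maxIdeal (f : ring k n) :
    ∃ c : k, f - algebraMap k (ring k n) c ∈ maxIdeal k n := by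
  refine ⟨PowerSeries.coeff 0 (f : k⟦X⟧), ?_⟩
  rw [← pow_one (maxIdeal k n), mem_maxIdeal_pow]
  intro a ha
  change PowerSeries.coeff a ((f : k⟦X⟧) - PowerSeries.C (PowerSeries.coeff 0 (f : k⟦X⟧))) ≠ 0 at ha
  have ha0 : a ≠ 0 := by
    rintro rfl
    simp at ha
  have hfa : PowerSeries.coeff a (f : k⟦X⟧) ≠ 0 := by
    simpa [PowerSeries.coeff_C, ha0] using ha
  obtain ⟨u, -, hu⟩ := hasOrder_zero_iff.mpr (f.2 a hfa)
  refine ⟨u, Nat.one_le_iff_ne_zero.mpr fun h => ha0 ?_, hu⟩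
  rw [← hu]
  refine Finset.sum_eq_zero fun j hj => ?_
  rw [Finset.sum_eq_zero_iff.mp h j hj, zero_mul]

theorem mem_span_gen_of_forall {l : Fin d} {f : ring k n}
    (hf : ∀ a, PowerSeries.coeff a (f : k⟦X⟧) ≠ 0 → ∃ b ∈ semigroup n, a = n l + b) :
    f ∈ Ideal.span {gen k n l} := by
  rw [Ideal.mem_span_singleton]
  refine ⟨⟨PowerSeries.mk fun c => PowerSeries.coeff (n l + c) (f : k⟦X⟧), ?_⟩, ?_⟩
  · intro c hc
    obtain ⟨b, hb, h⟩ := hf _ (by simpa using hc)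
    rwa [Nat.add_left_cancel h]
  · apply Subtype.ext
    ext a
    change _ = PowerSeries.coeff a ((PowerSeries.X : k⟦X⟧) ^ n l *
      PowerSeries.mk fun c => PowerSeries.coeff (n l + c) (f : k⟦X⟧))
    rw [PowerSeries.coeff_X_pow_mul']
    split_ifs with h
    · simp [Nat.add_sub_cancel' h]
    · by_contra ha
      obtain ⟨b, -, hb⟩ := hf a ha
      omega

/-- The monomial `tᵃ` of `R`. -/
noncomputable def monomialOfMem (k : Type*) [Field k] {a : ℕ} (ha : a ∈ semigroup n) : ring k n :=
  ⟨PowerSeries.X ^ a, by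
    intro b hb
    rw [PowerSeries.coeff_X_pow] at hb
    have h : b = a := by
      by_contra hne
      exact hb (if_neg hne)
    exact h ▸ ha⟩

theorem monomialOfMem_mem_maxIdeal_pow {i a : ℕ} (h : HasOrder n i a) :
    monomialOfMem k h.mem_semigroup ∈ maxIdeal k n ^ i := by
  rw [mem_maxIdeal_pow]
  intro b hb
  have h' : b = a := by
    by_contra hne
    exact hb ((PowerSeries.coeff_X_pow _ _).trans (if_neg hne))
  exact h' ▸ h

theorem exists_hasOrder_of_mem_span_gen_mul {l : Fin d} {a : ℕ} (ha : a ∈ semigroup n) {i : ℕ}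
    (h : monomialOfMem k ha ∈ Ideal.span {gen k n l} * maxIdeal k n ^ i) :
    ∃ b, HasOrder n i b ∧ n l + b = a := by
  rw [Ideal.mem_span_singleton_mul] at h
  obtain ⟨g, hg, h⟩ := h
  have h1 : PowerSeries.coeff a (PowerSeries.X ^ n l * (g : k⟦X⟧)) = 1 := by
    have := congrArg (fun f : ring k n => PowerSeries.coeff a (f : k⟦X⟧)) h
    refine this.trans ?_
    change PowerSeries.coeff a (PowerSeries.X ^ a : k⟦X⟧) = 1
    simp [PowerSeries.coeff_X_pow]
  rw [PowerSeries.coeff_X_pow_mul'] at h1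
  split_ifs at h1 with hle
  · exact ⟨a - n l, mem_maxIdeal_pow.mp hg _ (by rw [h1]; exact one_ne_zero), by omega⟩
  · exact absurd h1 zero_ne_one

theorem mem_maxIdeal_pow_of_gen_mul_mem {l : Fin d}
    (hord : ∀ i a, a ∈ semigroup n → HasOrder n (i + 1) (n l + a) → HasOrder n i a)
    (i : ℕ) (f : ring k n) (hf : gen k n l * f ∈ maxIdeal k n ^ (i + 1)) :
    f ∈ maxIdeal k n ^ i := by
  rw [mem_maxIdeal_pow] at hf ⊢
  intro a ha
  refine hord i a (f.2 a ha) (hf _ ?_)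
  change PowerSeries.coeff (n l + a) (PowerSeries.X ^ n l * (f : k⟦X⟧)) ≠ 0
  rwa [add_comm, PowerSeries.coeff_X_pow_mul]

end

/-! ### Three generators: powers of 𝔪 contained in Q -/

section

variable {n : Fin 3 → ℕ}

theorem hasOrder_iff_three {i a : ℕ} :
    HasOrder n i a ↔ ∃ u v w, i ≤ u + v + w ∧ u * n 0 + v * n 1 + w * n 2 = a := by
  constructor
  · rintro ⟨u, hu, h⟩
    exact ⟨u 0, u 1, u 2, by simpa [Fin.sum_univ_three] using hu,
      by simpa [Fin.sum_univ_three] using h⟩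
  · rintro ⟨u, v, w, hu, h⟩
    exact ⟨![u, v, w], by simpa [Fin.sum_univ_three] using hu,
      by simpa [Fin.sum_univ_three] using h⟩

variable {k : Type*} [Field k]

theorem maxIdeal_pow_le_span_gen {s : ℕ}
    (h : ∀ b c, b + c = s → ∃ u v w,
      b * n 1 + c * n 2 = (u + 1) * n 0 + v * n 1 + w * n 2) :
    maxIdeal k n ^ s ≤ Ideal.span {gen k n 0} := by
  intro f hf
  refine mem_span_gen_of_forall fun a ha => ?_
  obtain ⟨u, v, w, hu, rfl⟩ := hasOrder_iff_three.mp (mem_maxIdeal_pow.mp hf a ha)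
  have key : ∃ u' v' w', u * n 0 + v * n 1 + w * n 2 = (u' + 1) * n 0 + v' * n 1 + w' * n 2 := by
    rcases u with _ | u
    -- A sum of at least s copies of the two larger generators contains a subsum of exactly s of
    -- them.
    · obtain ⟨b, c, hb, hc, hbc⟩ : ∃ b c, b ≤ v ∧ c ≤ w ∧ b + c = s :=
        ⟨min v s, s - min v s, by omega, by omega, by omega⟩
      obtain ⟨u', v', w', h1⟩ := h b c hbc
      obtain ⟨v, rfl⟩ := Nat.exists_eq_add_of_le hb
      obtain ⟨w, rfl⟩ := Nat.exists_eq_add_of_le hc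
      exact ⟨u', v' + v, w' + w, by linarith⟩
    · exact ⟨u, v, w, rfl⟩
  obtain ⟨u', v', w', h1⟩ := key
  refine ⟨u' * n 0 + v' * n 1 + w' * n 2, ?_, by rw [h1]; ring⟩
  exact hasOrder_zero_iff.mp (hasOrder_iff_three.mpr ⟨u', v', w', Nat.zero_le _, rfl⟩)

theorem not_maxIdeal_le_span_gen (hmono : StrictMono n)
    (hmin : IsMinimalGenerators n) : ¬ maxIdeal k n ≤ Ideal.span {gen k n 0} := by
  intro h
  have h1 := monomialOfMem_mem_maxIdeal_pow (k := k) (hasOrder_gen (n := n) 1)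
  rw [pow_one] at h1
  obtain ⟨b, hb, h2⟩ := exists_hasOrder_of_mem_span_gen_mul (k := k) (l := 0) (i := 0)
    (hasOrder_gen (n := n) 1).mem_semigroup (by simpa using h h1)
  obtain ⟨u, v, w, -, rfl⟩ := hasOrder_iff_three.mp hb
  have h12 : n 1 < n 2 := hmono (by decide)
  have h01 : n 0 < n 1 := hmono (by decide)
  by_cases hv : v = 0
  · by_cases hw : w = 0
    · refine hmin 1 ?_
      have h3 : (u + 1) • n 0 = n 1 := by
        rw [smul_eq_mul, ← h2, hv, hw]
        ring
      rw [← h3]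
      exact AddSubmonoid.nsmul_mem _ (AddSubmonoid.subset_closure
        (Set.mem_image_of_mem n (show (0 : Fin 3) ∈ {j | j ≠ 1} by simp))) _
    · have := Nat.le_mul_of_pos_left (n 2) (Nat.pos_of_ne_zero hw)
      omega
  · have := Nat.le_mul_of_pos_left (n 1) (Nat.pos_of_ne_zero hv)
    have h3 : n 0 = 0 := by omega
    refine hmin 0 ?_
    rw [h3]
    exact zero_mem _

theorem exists_maxIdeal_pow_le_span_gen (hpos : ∀ i, 0 < n i) :
    ∃ s, maxIdeal k n ^ (s + 1) ≤ Ideal.span {gen k n 0} := by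
  -- With 2n₀ + 1 summands one of the larger generators occurs at least n₀ times, and n₀ copies of
  -- it equal a positive multiple of n₀.
  refine ⟨2 * n 0, maxIdeal_pow_le_span_gen fun b c hbc => ?_⟩
  by_cases hb : n 0 ≤ b
  · obtain ⟨v, rfl⟩ := Nat.exists_eq_add_of_le hb
    obtain ⟨m, hm⟩ := Nat.exists_eq_add_of_le' (hpos 1)
    exact ⟨m, v, c, by rw [hm]; ring⟩
  · obtain ⟨w, rfl⟩ := Nat.exists_eq_add_of_le (show n 0 ≤ c by omega)
    obtain ⟨m, hm⟩ := Nat.exists_eq_add_of_le' (hpos 2)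
    exact ⟨m, b, w, by rw [hm]; ring⟩

end

end NumericalSemigroupRing

/-! ### The main theorem -/

theorem mainTheorem5 (k : Type*) [Field k] [CharZero k] (n : Fin 3 → ℕ)
    (hpos : ∀ i, 0 < n i) (hmono : StrictMono n) (hgcd : Finset.univ.gcd n = 1)
    (hmin : NumericalSemigroupRing.IsMinimalGenerators n)
    (hsr : TangentCone.nilpotencyIndex (Ideal.span {NumericalSemigroupRing.gen k n 0})
        (NumericalSemigroupRing.maxIdeal k n) =
      TangentCone.reductionNumber (Ideal.span {NumericalSemigroupRing.gen k n 0})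
        (NumericalSemigroupRing.maxIdeal k n)) :
    TangentCone.IsCohenMacaulay
      (TangentCone.associatedGraded (NumericalSemigroupRing.maxIdeal k n)) := by
  open NumericalSemigroupRing TangentCone in
  have h01 : n 0 < n 1 := hmono (by decide)
  have h12 : n 1 < n 2 := hmono (by decide)
  have hnil : maxIdeal k n ^ (nilpotencyIndex (Ideal.span {gen k n 0}) (maxIdeal k n) + 1) ≤
      Ideal.span {gen k n 0} := Nat.sInf_mem (exists_maxIdeal_pow_le_span_gen hpos)
  have hne : {r | maxIdeal k n ^ (r + 1) =
      Ideal.span {gen k n 0} * maxIdeal k n ^ r}.Nonempty := by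
    -- The infimum of the empty set is 0, so without a reduction exponent the equality of indices
    -- would give 𝔪 ⊆ Q, contrary to minimal generation.
    by_contra! hempty
    have h0 : reductionNumber (Ideal.span {gen k n 0}) (maxIdeal k n) = 0 := by
      rw [reductionNumber, hempty, Nat.sInf_empty]
    rw [hsr, h0, zero_add, pow_one] at hnil
    exact not_maxIdeal_le_span_gen hmono hmin hnil
  have hred : maxIdeal k n ^ (reductionNumber (Ideal.span {gen k n 0}) (maxIdeal k n) + 1) =
      Ideal.span {gen k n 0} *
        maxIdeal k n ^ reductionNumber (Ideal.span {gen k n 0}) (maxIdeal k n) :=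
    Nat.sInf_mem hne
  -- Here the equality of indices enters: 𝔪^s ⊄ Q for the same s at which 𝔪^{s+1} = Q𝔪^s.
  have hap : ∃ b c, b + c = reductionNumber (Ideal.span {gen k n 0}) (maxIdeal k n) ∧
      ∀ u v w, b * n 1 + c * n 2 ≠ (u + 1) * n 0 + v * n 1 + w * n 2 := by
    by_contra! hap
    refine not_pow_nilpotencyIndex_le (Q := Ideal.span {gen k n 0}) (I := maxIdeal k n)
      (fun h => not_maxIdeal_le_span_gen hmono hmin (h ▸ le_top)) ?_
    rw [hsr]
    exact maxIdeal_pow_le_span_gen hap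
  generalize reductionNumber (Ideal.span {gen k n 0}) (maxIdeal k n) = s at hred hap
  obtain ⟨b₀, c₀, hbc, hw⟩ := hap
  have hstep : ∀ b c, b + c = s + 1 →
      ∃ u v w, (u + 1) * n 0 + v * n 1 + w * n 2 = b * n 1 + c * n 2 ∧ s ≤ u + v + w := by
    intro b c h
    have ho : HasOrder n (s + 1) (b * n 1 + c * n 2) :=
      hasOrder_iff_three.mpr ⟨0, b, c, by omega, by ring⟩
    have h1 := monomialOfMem_mem_maxIdeal_pow (k := k) ho
    rw [hred] at h1
    obtain ⟨e, he, h2⟩ := exists_hasOrder_of_mem_span_gen_mul _ h1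
    obtain ⟨u, v, w, h3, rfl⟩ := hasOrder_iff_three.mp he
    exact ⟨u, v, w, by rw [← h2]; ring, h3⟩
  refine isCohenMacaulay_associatedGraded (x := gen k n 0) k (Ideal.subset_span ⟨0, rfl⟩)
    (Submodule.fg_span (Set.finite_range _)) exists_sub_algebraMap_mem_maxIdeal hred
    (mem_maxIdeal_pow_of_gen_mul_mem ?_)
  intro i a ha hia
  obtain ⟨a₁, a₂, a₃, -, rfl⟩ := hasOrder_iff_three.mp (hasOrder_zero_iff.mpr ha)
  obtain ⟨b₁, b₂, b₃, hi, hb⟩ := hasOrder_iff_three.mp hia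
  obtain ⟨u, v, w, h1, h2⟩ := order_add_smallest (hpos 0) h01 h12 hstep hbc hw b₁ b₂ b₃ a₁ a₂ a₃
    (by rw [hb]; ring)
  exact hasOrder_iff_three.mpr ⟨u, v, w, by omega, h1⟩
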